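/- All logarithms are to base $2$. There is an absolute constant $C>0$ such that the following holds for every function $m:\mathbb N\to\mathbb N$ with $4\log n\le m(n)\le 2^{n-1}$ for all sufficiently large $n$. For almost all boolean functions $f:\{0,1\}^n\to\{0,1\}$ of weight $\mathrm{wt}(f)=|f^{-1}(1)|=m(n)$, \[ \mathrm{D}_{\mathrm{ave}}(f)\;\ge\;\min_{x\in\{0,1\}^n}\mathrm{C}_x(f)\;\ge\;\log\frac{m(n)}{\log n}-C\,\log\log\frac{m(n)}{\log n}; \] that is, as $n\to\infty$, the fraction of those $f$ for which these inequalities hold, among all $f:\{0,1\}^n\to\{0,1\}$ of weight $m(n)$, tends to $1$. Here $\mathrm{D}_{\mathrm{ave}}(f)$ is the minimum, over all deterministic decision trees $T$ with $T(x)=f(x)$ for every $x\in\{0,1\}^n$, of the average number of queries made by $T$ on a uniformly random input $x\in\{0,1\}^n$; and $\mathrm{C}_x(f)$ is the size of a smallest certificate on input $x$, i.e. of a smallest set $S\subseteq\{1,\dots,n\}$ such that $f(y)=f(x)$ for every $y\in\{0,1\}^n$ with $y_i=x_i$ for all $i\in S$. -/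

import Mathlib

open Filter Topology

/-- An `n`-variable boolean function `{0,1}ⁿ → {0,1}`. -/
abbrev BoolFun (n : ℕ) : Type := (Fin n → Bool) → Bool

namespace BoolFun

/-- The weight of `f`: the number of inputs on which `f` outputs `1`. -/
def weight {n : ℕ} (f : BoolFun n) : ℕ :=
  (Finset.univ.filter fun x => f x = true).card

/-- The set of all `n`-variable boolean functions of weight `m`. -/
def ofWeight (n m : ℕ) : Set (BoolFun n) :=
  {f | f.weight = m}

/-- `S` is a certificate for `f` on input `x`: every input that agrees with `x` on `S` has the
same value as `x`. -/
def IsCertificate {n : ℕ} (f : BoolFun n) (x : Fin n → Bool) (S : Finset (Fin n)) : Prop :=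
  ∀ y : Fin n → Bool, (∀ i ∈ S, x i = y i) → f x = f y

/-- The set of all variables is always a certificate. -/
theorem isCertificate_univ {n : ℕ} (f : BoolFun n) (x : Fin n → Bool) :
    f.IsCertificate x Finset.univ := by
  intro y hy
  rw [show x = y from funext fun i => hy i (Finset.mem_univ i)]

/-- The certificate complexity of `f` on input `x`: the size of a smallest certificate.
The infimum is over a nonempty set of natural numbers, hence it is a minimum. -/
noncomputable def certComplexity {n : ℕ} (f : BoolFun n) (x : Fin n → Bool) : ℕ :=
  sInf {k : ℕ | ∃ S : Finset (Fin n), f.IsCertificate x S ∧ S.card = k}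

theorem certComplexity_isLeast {n : ℕ} (f : BoolFun n) (x : Fin n → Bool) :
    IsLeast {k : ℕ | ∃ S : Finset (Fin n), f.IsCertificate x S ∧ S.card = k}
      (f.certComplexity x) :=
  ⟨Nat.sInf_mem ⟨_, Finset.univ, f.isCertificate_univ x, rfl⟩, fun _ hk => Nat.sInf_le hk⟩

/-- The minimum over all inputs `x` of the certificate complexity of `f` on `x`. -/
noncomputable def minCertComplexity {n : ℕ} (f : BoolFun n) : ℕ :=
  Finset.univ.inf' Finset.univ_nonempty f.certComplexity

end BoolFun

/-- Deterministic decision trees on `n` boolean variables. In `node i l r` the variable `i` is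
queried; the tree continues with `l` if the answer is `0` and with `r` if the answer is `1`. -/
inductive DecisionTree (n : ℕ) : Type
  | leaf (b : Bool) : DecisionTree n
  | node (i : Fin n) (l r : DecisionTree n) : DecisionTree n

namespace DecisionTree

/-- The value `T(x)`: the label of the leaf that is reached on input `x`. -/
def eval {n : ℕ} : DecisionTree n → (Fin n → Bool) → Bool
  | leaf b, _ => b
  | node i l r, x => if x i = true then r.eval x else l.eval x

/-- The number of queries made by the tree on input `x`, i.e. the length of the path from the
root to the leaf that is reached. -/
def cost {n : ℕ} : DecisionTree n → (Fin n → Bool) → ℕ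
  | leaf _, _ => 0
  | node i l r, x => (if x i = true then r.cost x else l.cost x) + 1

/-- The tree computes `f` with zero error. -/
def Computes {n : ℕ} (T : DecisionTree n) (f : BoolFun n) : Prop :=
  ∀ x, T.eval x = f x

/-- The average cost of the tree on a uniformly random input. -/
noncomputable def avgCost {n : ℕ} (T : DecisionTree n) : ℝ :=
  (∑ x : Fin n → Bool, (T.cost x : ℝ)) / 2 ^ n

/-- If `f` depends only on the variables in `S`, then some decision tree computes `f`. -/
theorem exists_computes_aux {n : ℕ} (S : Finset (Fin n)) :
    ∀ f : BoolFun n, (∀ x y : Fin n → Bool, (∀ i ∈ S, x i = y i) → f x = f y) →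
      ∃ T : DecisionTree n, T.Computes f := by
  induction S using Finset.induction_on with
  | empty =>
    intro f hf
    exact ⟨leaf (f fun _ => false), fun x => hf _ _ (by simp)⟩
  | insert i S _ ih =>
    intro f hf
    have key : ∀ b : Bool, ∃ T : DecisionTree n,
        T.Computes fun x => f (Function.update x i b) := by
      intro b
      refine ih _ fun x y hxy => hf _ _ fun j hj => ?_
      by_cases hji : j = i
      · subst hji; simp
      · simp [hji, hxy j (Finset.mem_of_mem_insert_of_ne hj hji)]
    obtain ⟨l, hl⟩ := key false
    obtain ⟨r, hr⟩ := key true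
    refine ⟨node i l r, fun x => ?_⟩
    cases hx : x i with
    | true =>
      have hu : Function.update x i true = x := by rw [← hx, Function.update_eq_self]
      have h := hr x
      simp only [hu] at h
      simpa [eval, hx] using h
    | false =>
      have hu : Function.update x i false = x := by rw [← hx, Function.update_eq_self]
      have h := hl x
      simp only [hu] at h
      simpa [eval, hx] using h

/-- Every boolean function is computed by some decision tree. -/
theorem exists_computes {n : ℕ} (f : BoolFun n) : ∃ T : DecisionTree n, T.Computes f :=
  exists_computes_aux Finset.univ f fun x y h => by
    rw [show x = y from funext fun i => h i (Finset.mem_univ i)]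

end DecisionTree

namespace BoolFun

/-- The average-case deterministic query complexity of `f` under the uniform distribution: the
minimum average cost of a decision tree that computes `f` with zero error. -/
noncomputable def dAve {n : ℕ} (f : BoolFun n) : ℝ :=
  sInf {a : ℝ | ∃ T : DecisionTree n, T.Computes f ∧ T.avgCost = a}

/-- The infimum in the definition of `dAve` is a minimum. -/
theorem dAve_isLeast {n : ℕ} (f : BoolFun n) :
    IsLeast {a : ℝ | ∃ T : DecisionTree n, T.Computes f ∧ T.avgCost = a} f.dAve := by
  obtain ⟨T₀, hT₀⟩ := DecisionTree.exists_computes f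
  obtain ⟨T, hT, hm⟩ := Nat.sInf_mem
    (s := {k : ℕ | ∃ T : DecisionTree n, T.Computes f ∧ ∑ x, T.cost x = k}) ⟨_, T₀, hT₀, rfl⟩
  have h : IsLeast {a : ℝ | ∃ T : DecisionTree n, T.Computes f ∧ T.avgCost = a} T.avgCost := by
    refine ⟨⟨T, hT, rfl⟩, ?_⟩
    rintro _ ⟨T', hT', rfl⟩
    have hle : ∑ x, T.cost x ≤ ∑ x, T'.cost x := hm ▸ Nat.sInf_le ⟨T', hT', rfl⟩
    unfold DecisionTree.avgCost
    gcongr ?_ / _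
    exact_mod_cast hle
  have e : f.dAve = T.avgCost := h.csInf_eq
  rw [e]
  exact h

end BoolFun

/-- For almost all `n`-variable boolean functions of weight `m n`, the property `P` holds: as
`n → ∞`, the fraction of the functions with property `P` among all `n`-variable boolean functions
of weight `m n` tends to `1`. -/
def AlmostAllOfWeight (m : ℕ → ℕ) (P : ∀ n : ℕ, BoolFun n → Prop) : Prop :=
  Tendsto
    (fun n : ℕ => ({f ∈ BoolFun.ofWeight n (m n) | P n f}.ncard : ℝ) /
      ((BoolFun.ofWeight n (m n)).ncard : ℝ))
    atTop (𝓝 1)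

/-! The variables queried on `x` form a certificate, so every input costs at least the minimum
certificate complexity, and so does the average. The second inequality is a union bound over
subcubes. A subcube of codimension `K` has density `2^(-K)`, so a random `f` of weight `m ≤ 2^(n-1)`
is constant on it with probability at most `2 exp(-m/2^K)` (`card_weight_and_const_on_subcube_le`).
Let `l = log n` and `L = log (m/l)`. There are `n.choose K * 2^K ≤ exp(2lL)` such subcubes, while `K
≤ L - 3 log L` gives `m/2^K ≥ l L^3`, which wins: the bad fraction is at most `2/n`. -/

namespace DecisionTree

variable {n : ℕ}

/-- The set of variables queried by the tree on input `x`. -/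
def queried : DecisionTree n → (Fin n → Bool) → Finset (Fin n)
  | leaf _, _ => ∅
  | node i l r, x => insert i (if x i = true then r.queried x else l.queried x)

theorem card_queried_le_cost (T : DecisionTree n) (x : Fin n → Bool) :
    (T.queried x).card ≤ T.cost x := by
  induction T with
  | leaf b => simp [queried]
  | node i l r ihl ihr =>
    refine (Finset.card_insert_le _ _).trans ?_
    simp only [cost]
    split_ifs <;> omega

theorem eval_eq_of_agree_on_queried (T : DecisionTree n) (x y : Fin n → Bool)
    (h : ∀ i ∈ T.queried x, x i = y i) : T.eval x = T.eval y := by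
  induction T with
  | leaf b => rfl
  | node i l r ihl ihr =>
    simp only [queried, Finset.mem_insert, forall_eq_or_imp] at h
    obtain ⟨hi, h⟩ := h
    simp only [eval, ← hi]
    split_ifs at h ⊢
    · exact ihr h
    · exact ihl h

theorem Computes.certComplexity_le_cost {T : DecisionTree n} {f : BoolFun n} (hT : T.Computes f)
    (x : Fin n → Bool) : f.certComplexity x ≤ T.cost x := by
  refine le_trans ((f.certComplexity_isLeast x).2 ⟨T.queried x, fun y hy => ?_, rfl⟩)
    (T.card_queried_le_cost x)
  rw [← hT x, ← hT y, T.eval_eq_of_agree_on_queried x y hy]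

end DecisionTree

namespace BoolFun

variable {n : ℕ}

theorem minCertComplexity_le_dAve (f : BoolFun n) : (f.minCertComplexity : ℝ) ≤ f.dAve := by
  obtain ⟨T, hT, hTa⟩ := f.dAve_isLeast.1
  rw [← hTa, DecisionTree.avgCost, le_div_iff₀ (by positivity)]
  have h : ∑ _x : Fin n → Bool, (f.minCertComplexity : ℝ) ≤ ∑ x, (T.cost x : ℝ) := by
    refine Finset.sum_le_sum fun x _ => ?_
    have h₁ : f.minCertComplexity ≤ f.certComplexity x := Finset.inf'_le _ (Finset.mem_univ x)
    exact_mod_cast h₁.trans (hT.certComplexity_le_cost x)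
  simpa [mul_comm] using h

/-! ### Counting functions of given weight with prescribed values. -/

/-- Boolean functions correspond to the sets of inputs on which they output `1`. -/
def equivFinset (n : ℕ) : BoolFun n ≃ Finset (Fin n → Bool) where
  toFun f := Finset.univ.filter fun x => f x = true
  invFun s x := decide (x ∈ s)
  left_inv f := by ext x; simp
  right_inv s := by ext x; simp

theorem card_weight_and_eq_false_on (m : ℕ) (Q : Finset (Fin n → Bool)) :
    (Finset.univ.filter fun f : BoolFun n => f.weight = m ∧ ∀ y ∈ Q, f y = false).card =
      (2 ^ n - Q.card).choose m := by
  have hQ : Qᶜ.card = 2 ^ n - Q.card := by simp [Finset.card_compl]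
  rw [← hQ, ← Finset.card_powersetCard]
  refine Finset.card_equiv (equivFinset n) fun f => ?_
  rw [Finset.mem_filter]
  simp only [Finset.mem_univ, true_and, Finset.mem_powersetCard, equivFinset,
    Equiv.coe_fn_mk, weight, Finset.subset_iff, Finset.mem_compl]
  rw [and_comm]
  refine and_congr_left fun _ => forall_congr' fun y => ?_
  cases h : f y <;> simp [h]

theorem weight_not_add_weight (f : BoolFun n) :
    weight (fun x => !f x) + f.weight = 2 ^ n := by
  have h := Finset.card_filter_add_card_filter_not
    (s := (Finset.univ : Finset (Fin n → Bool))) (fun x => f x = true)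
  simp only [Finset.card_univ, Fintype.card_pi, Fintype.card_bool, Finset.prod_const,
    Fintype.card_fin] at h
  simp only [weight, Bool.not_eq_true'] at h ⊢
  simp only [Bool.not_eq_true] at h
  omega

/-- Negation exchanges weights `m` and `2^n - m`, which reduces this to the count of functions
vanishing on `Q`. -/
theorem card_weight_and_eq_true_on {m : ℕ} (hm : m ≤ 2 ^ n) (Q : Finset (Fin n → Bool)) :
    (Finset.univ.filter fun f : BoolFun n => f.weight = m ∧ ∀ y ∈ Q, f y = true).card =
      (2 ^ n - Q.card).choose (2 ^ n - m) := by
  rw [← card_weight_and_eq_false_on]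
  let e : BoolFun n ≃ BoolFun n :=
    { toFun := fun f x => !f x
      invFun := fun f x => !f x
      left_inv := fun f => by ext; simp
      right_inv := fun f => by ext; simp }
  refine Finset.card_equiv e fun f => ?_
  have h := f.weight_not_add_weight
  simp only [Finset.mem_filter, Finset.mem_univ, true_and, e, Equiv.coe_fn_mk,
    Bool.not_eq_false']
  refine and_congr_left fun _ => ?_
  omega

theorem ofWeight_eq_coe (n m : ℕ) :
    ofWeight n m = ↑(Finset.univ.filter fun f : BoolFun n => f.weight = m) := by
  ext f; simp [ofWeight]

theorem ncard_ofWeight (n m : ℕ) : (ofWeight n m).ncard = (2 ^ n).choose m := by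
  rw [ofWeight_eq_coe, Set.ncard_coe_finset]
  simpa using card_weight_and_eq_false_on (n := n) m ∅

end BoolFun

/-! ### Ratios of binomial coefficients. -/

/-- Factor by factor, `(M - k)/M ≤ (N - k)/N`; truncated subtraction keeps this valid for `k > M`.
-/
theorem Nat.descFactorial_mul_pow_le {M N : ℕ} (h : M ≤ N) (k : ℕ) :
    M.descFactorial k * N ^ k ≤ N.descFactorial k * M ^ k := by
  induction k with
  | zero => simp
  | succ k ih =>
    have h₁ : (M - k) * N ≤ (N - k) * M := by
      rw [Nat.sub_mul, Nat.sub_mul, mul_comm N M]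
      exact Nat.sub_le_sub_left (Nat.mul_le_mul_left k h) _
    calc M.descFactorial (k + 1) * N ^ (k + 1)
        = ((M - k) * N) * (M.descFactorial k * N ^ k) := by
          rw [Nat.descFactorial_succ, pow_succ]; ring
      _ ≤ ((N - k) * M) * (N.descFactorial k * M ^ k) := Nat.mul_le_mul h₁ ih
      _ = N.descFactorial (k + 1) * M ^ (k + 1) := by
          rw [Nat.descFactorial_succ, pow_succ]; ring

theorem Nat.choose_mul_pow_le {M N : ℕ} (h : M ≤ N) (k : ℕ) :
    M.choose k * N ^ k ≤ N.choose k * M ^ k := by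
  have h₁ := Nat.descFactorial_mul_pow_le h k
  rw [Nat.descFactorial_eq_factorial_mul_choose, Nat.descFactorial_eq_factorial_mul_choose,
    mul_assoc, mul_assoc] at h₁
  exact Nat.le_of_mul_le_mul_left h₁ k.factorial_pos

theorem Nat.choose_sub_le_mul_exp {N q : ℕ} (hN : 0 < N) (hq : q ≤ N) (k : ℕ) :
    ((N - q).choose k : ℝ) ≤ N.choose k * Real.exp (-(k * (q / N))) := by
  have hN' : (0 : ℝ) < N := by exact_mod_cast hN
  have h : ((N - q).choose k : ℝ) * (N : ℝ) ^ k ≤ N.choose k * ((N - q : ℕ) : ℝ) ^ k := by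
    exact_mod_cast Nat.choose_mul_pow_le (Nat.sub_le N q) k
  rw [Nat.cast_sub hq] at h
  have h₁ : (((N : ℝ) - q) / N) ^ k ≤ Real.exp (-(k * (q / N))) := by
    rw [← mul_neg, Real.exp_nat_mul]
    refine pow_le_pow_left₀ (div_nonneg (sub_nonneg.2 (by exact_mod_cast hq)) hN'.le) ?_ k
    rw [sub_div, div_self hN'.ne']
    exact Real.one_sub_le_exp_neg _
  calc ((N - q).choose k : ℝ) ≤ N.choose k * (((N : ℝ) - q) / N) ^ k := by
        rw [div_pow, ← mul_div_assoc, le_div_iff₀ (by positivity)]; exact h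
    _ ≤ _ := by gcongr

/-! ### Union bound over subcubes. -/

namespace BoolFun

variable {n : ℕ}

/-- The subcube of inputs which agree with `x` on `S`. -/
def subcube (S : Finset (Fin n)) (x : Fin n → Bool) : Finset (Fin n → Bool) :=
  Finset.univ.filter fun y => ∀ i ∈ S, x i = y i

theorem card_subcube (S : Finset (Fin n)) (x : Fin n → Bool) :
    (subcube S x).card = 2 ^ (n - S.card) := by
  have h : subcube S x = Fintype.piFinset fun i => if i ∈ S then {x i} else Finset.univ := by
    ext y
    simp only [subcube, Finset.mem_filter, Finset.mem_univ, true_and, Fintype.mem_piFinset]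
    refine forall_congr' fun i => ?_
    by_cases hi : i ∈ S
    · simpa [hi] using eq_comm
    · simp [hi]
  rw [h, Fintype.card_piFinset]
  have h₂ : ∀ i, (if i ∈ S then {x i} else (Finset.univ : Finset Bool)).card =
      if i ∈ S then 1 else 2 := fun i => by split_ifs <;> simp
  simp only [h₂, Finset.prod_ite, Finset.prod_const_one, one_mul, Finset.prod_const]
  congr 1
  rw [← Finset.compl_filter, Finset.card_compl]
  simp

/-- The functions of weight `m` that are constant on the subcube fixed by `S` and `x`. -/
theorem card_weight_and_const_on_subcube_le {m : ℕ} (hm : 2 * m ≤ 2 ^ n) (S : Finset (Fin n))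
    (x : Fin n → Bool) :
    ((Finset.univ.filter fun f : BoolFun n =>
        f.weight = m ∧ ∀ y ∈ subcube S x, f x = f y).card : ℝ) ≤
      2 * (2 ^ n).choose m * Real.exp (-(m / 2 ^ S.card)) := by
  set Q := subcube S x
  have hsub : (Finset.univ.filter fun f : BoolFun n => f.weight = m ∧ ∀ y ∈ Q, f x = f y) ⊆
      (Finset.univ.filter fun f : BoolFun n => f.weight = m ∧ ∀ y ∈ Q, f y = false) ∪
      (Finset.univ.filter fun f : BoolFun n => f.weight = m ∧ ∀ y ∈ Q, f y = true) := by
    intro f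
    simp only [Finset.mem_union, Finset.mem_filter, Finset.mem_univ, true_and]
    rintro ⟨hw, hf⟩
    cases hx : f x with
    | false => exact Or.inl ⟨hw, fun y hy => by rw [← hf y hy, hx]⟩
    | true => exact Or.inr ⟨hw, fun y hy => by rw [← hf y hy, hx]⟩
  have hS : S.card ≤ n := by simpa using S.card_le_univ
  have hq : Q.card = 2 ^ (n - S.card) := card_subcube S x
  have hqN : Q.card ≤ 2 ^ n := hq ▸ Nat.pow_le_pow_right two_pos (Nat.sub_le _ _)
  have hdens : (Q.card : ℝ) / ((2 ^ n : ℕ) : ℝ) = 1 / 2 ^ S.card := by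
    rw [hq, div_eq_div_iff (by positivity) (by positivity)]
    norm_cast
    rw [one_mul, ← pow_add, Nat.sub_add_cancel hS]
  have h₀ := Nat.choose_sub_le_mul_exp (pow_pos two_pos n) hqN m
  have h₁ := Nat.choose_sub_le_mul_exp (pow_pos two_pos n) hqN (2 ^ n - m)
  rw [Nat.choose_symm (by omega : m ≤ 2 ^ n)] at h₁
  rw [hdens] at h₀ h₁
  -- At most half of the inputs map to `1`, so the bound for constant `1` is no worse than the one
  -- for constant `0`.
  have hexp : Real.exp (-(((2 ^ n - m : ℕ) : ℝ) * (1 / 2 ^ S.card))) ≤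
      Real.exp (-((m : ℝ) * (1 / 2 ^ S.card))) := by
    have : (m : ℝ) ≤ ((2 ^ n - m : ℕ) : ℝ) := by exact_mod_cast (by omega : m ≤ 2 ^ n - m)
    gcongr
  have hcard := (Finset.card_le_card hsub).trans (Finset.card_union_le _ _)
  rw [card_weight_and_eq_false_on, card_weight_and_eq_true_on (by omega)] at hcard
  have hcard' : ((Finset.univ.filter fun f : BoolFun n =>
      f.weight = m ∧ ∀ y ∈ Q, f x = f y).card : ℝ) ≤
      (2 ^ n - Q.card).choose m + (2 ^ n - Q.card).choose (2 ^ n - m) := by exact_mod_cast hcard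
  have h₂ := h₁.trans (mul_le_mul_of_nonneg_left hexp (Nat.cast_nonneg _))
  rw [mul_one_div] at h₀ h₂
  linarith

/-- Enlarging a certificate keeps it one, so the union bound only has to run over sets of size
exactly `K`. -/
theorem exists_certificate_of_minCertComplexity_le {f : BoolFun n} {K : ℕ} (hK : K ≤ n)
    (h : f.minCertComplexity ≤ K) : ∃ x S, S.card = K ∧ f.IsCertificate x S := by
  obtain ⟨x, -, hx⟩ := Finset.exists_mem_eq_inf' Finset.univ_nonempty f.certComplexity
  obtain ⟨S, hS, hc⟩ := (f.certComplexity_isLeast x).1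
  have hSK : S.card ≤ K := by rw [hc, ← hx]; exact h
  obtain ⟨S', hSS', hc'⟩ := Finset.exists_superset_card_eq hSK (by simpa using hK)
  exact ⟨x, S', hc', fun y hy => hS y fun i hi => hy i (hSS' hi)⟩

theorem card_weight_and_minCertComplexity_le {m K : ℕ} (hm : 2 * m ≤ 2 ^ n) (hK : K ≤ n) :
    ((Finset.univ.filter fun f : BoolFun n =>
        f.weight = m ∧ f.minCertComplexity ≤ K).card : ℝ) ≤
      n.choose K * 2 ^ K * (2 * (2 ^ n).choose m * Real.exp (-(m / 2 ^ K))) := by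
  -- A pair `(S, A)` with `A ⊆ S` encodes the subcube fixing `S` to the indicator of `A`; this
  -- indicator also serves as its base point.
  let I : Finset (Σ _ : Finset (Fin n), Finset (Fin n)) :=
    (Finset.univ.powersetCard K).sigma fun S => S.powerset
  let B : (Σ _ : Finset (Fin n), Finset (Fin n)) → Finset (BoolFun n) := fun p =>
    Finset.univ.filter fun f : BoolFun n => f.weight = m ∧
      ∀ y ∈ subcube p.1 (fun i => decide (i ∈ p.2)), f (fun i => decide (i ∈ p.2)) = f y
  have hsub : (Finset.univ.filter fun f : BoolFun n => f.weight = m ∧ f.minCertComplexity ≤ K) ⊆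
      I.biUnion B := by
    intro f hf
    simp only [Finset.mem_filter, Finset.mem_univ, true_and] at hf
    obtain ⟨x, S, hS, hc⟩ := exists_certificate_of_minCertComplexity_le hK hf.2
    refine Finset.mem_biUnion.2 ⟨⟨S, S.filter fun i => x i = true⟩, ?_, ?_⟩
    · simp [I, hS, Finset.mem_powersetCard]
    · have hx : ∀ i ∈ S, x i = decide (i ∈ S.filter fun i => x i = true) := fun i hi => by
        simp [hi]
      simp only [B, Finset.mem_filter, Finset.mem_univ, true_and, subcube]
      refine ⟨hf.1, fun y hy => ?_⟩
      rw [← hc y fun i hi => (hx i hi).trans (by simpa using hy i hi)]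
      symm
      refine hc _ fun i hi => ?_
      simp [hi]
  have hI : I.card = n.choose K * 2 ^ K := by
    rw [Finset.card_sigma, Finset.sum_congr rfl fun S hS => by
      rw [Finset.card_powerset, (Finset.mem_powersetCard.1 hS).2]]
    simp
  calc ((Finset.univ.filter fun f : BoolFun n =>
        f.weight = m ∧ f.minCertComplexity ≤ K).card : ℝ)
      ≤ ∑ p ∈ I, ((B p).card : ℝ) := by
        exact_mod_cast (Finset.card_le_card hsub).trans Finset.card_biUnion_le
    _ ≤ ∑ _p ∈ I, 2 * (2 ^ n).choose m * Real.exp (-(m / 2 ^ K)) := by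
        refine Finset.sum_le_sum fun p hp => ?_
        have hp₁ : p.1.card = K :=
          (Finset.mem_powersetCard.1 (Finset.mem_sigma.1 hp).1).2
        rw [← hp₁]
        exact card_weight_and_const_on_subcube_le hm p.1 _
    _ = _ := by
        rw [Finset.sum_const, nsmul_eq_mul, hI]
        push_cast
        ring

end BoolFun

/-! ### Numerical estimate and choice of `K`. -/

theorem choose_mul_two_pow_mul_exp_le {n m K : ℕ} (hn : 2 ≤ n)
    (hm : 4 * Real.logb 2 (n : ℝ) ≤ m)
    (hK : (K : ℝ) ≤ Real.logb 2 (m / Real.logb 2 n) -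
      3 * Real.logb 2 (Real.logb 2 (m / Real.logb 2 n))) :
    (n.choose K : ℝ) * 2 ^ K * Real.exp (-(m / 2 ^ K)) ≤ 1 / n := by
  have hn0 : (0 : ℝ) < n := by positivity
  have hn2 : (2 : ℝ) ≤ n := by exact_mod_cast hn
  set l := Real.logb 2 (n : ℝ) with hl
  have hl1 : 1 ≤ l := by
    rw [hl, Real.le_logb_iff_rpow_le (by norm_num) hn0]; simpa using hn2
  have hr4 : 4 ≤ (m : ℝ) / l := by rwa [le_div_iff₀ (by linarith)]
  have hr0 : 0 < (m : ℝ) / l := by linarith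
  set L := Real.logb 2 ((m : ℝ) / l) with hL
  have hL2 : 2 ≤ L := by
    rw [hL, Real.le_logb_iff_rpow_le (by norm_num) hr0]; norm_num; exact hr4
  have hL0 : 0 < L := by linarith
  have hLL : 0 ≤ Real.logb 2 L := Real.logb_nonneg (by norm_num) (by linarith)
  have hKL : (K : ℝ) ≤ L := by linarith
  have h2K : (2 : ℝ) ^ K ≤ (m / l) / L ^ 3 := by
    have e : Real.logb 2 ((m / l) / L ^ 3) = L - 3 * Real.logb 2 L := by
      rw [Real.logb_div hr0.ne' (by positivity), Real.logb_pow]; norm_num [hL]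
    rw [← e, Real.le_logb_iff_rpow_le (by norm_num) (by positivity), Real.rpow_natCast] at hK
    exact hK
  have hmK : l * L ^ 3 ≤ m / 2 ^ K := by
    rw [le_div_iff₀ (by positivity)]
    rw [le_div_iff₀ (by positivity), le_div_iff₀ (by linarith)] at h2K
    linarith
  have hlog2 : Real.log 2 ≤ 1 := by linarith [Real.log_two_lt_d9]
  have hlog2' : 0 < Real.log 2 := Real.log_pos (by norm_num)
  have hlogn : Real.log n = l * Real.log 2 := by
    rw [hl, Real.logb, div_mul_cancel₀ _ hlog2'.ne']
  have hlog : Real.log n ≤ l := by rw [hlogn]; nlinarith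
  have hcount : (n.choose K : ℝ) * 2 ^ K ≤ Real.exp (2 * l * L) := by
    have h₁ : (n.choose K : ℝ) ≤ (n : ℝ) ^ K := by exact_mod_cast Nat.choose_le_pow n K
    calc (n.choose K : ℝ) * 2 ^ K ≤ (n : ℝ) ^ K * 2 ^ K := by gcongr
      _ = Real.exp (K * (Real.log n + Real.log 2)) := by
          rw [Real.exp_nat_mul, Real.exp_add, Real.exp_log hn0, Real.exp_log two_pos, mul_pow]
      _ ≤ Real.exp (2 * l * L) := by
          refine Real.exp_le_exp.2 ?_
          calc (K : ℝ) * (Real.log n + Real.log 2) ≤ L * (2 * l) :=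
                mul_le_mul hKL (by linarith) (by rw [hlogn]; positivity) hL0.le
            _ = 2 * l * L := by ring
  calc (n.choose K : ℝ) * 2 ^ K * Real.exp (-(m / 2 ^ K))
      ≤ Real.exp (2 * l * L) * Real.exp (-(l * L ^ 3)) := by gcongr
    _ = Real.exp (-(l * (L ^ 3 - 2 * L))) := by rw [← Real.exp_add]; congr 1; ring
    _ ≤ Real.exp (-Real.log n) := by
        refine Real.exp_le_exp.2 (neg_le_neg (hlog.trans ?_))
        refine le_mul_of_one_le_right (by linarith) ?_
        -- `L ≥ 2`, which comes from `4 log n ≤ m`, gives `L^3 - 2L ≥ 4`.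
        nlinarith [mul_nonneg hL0.le (sub_nonneg.2 hL2), mul_nonneg (sq_nonneg L) (sub_nonneg.2 hL2)]
    _ = 1 / n := by rw [Real.exp_neg, Real.exp_log hn0, one_div]

namespace BoolFun

theorem card_weight_and_minCertComplexity_lt {n m : ℕ} (hn : 2 ≤ n)
    (hm : 4 * Real.logb 2 (n : ℝ) ≤ m) (hm' : m ≤ 2 ^ (n - 1)) :
    ((Finset.univ.filter fun f : BoolFun n => f.weight = m ∧
        (f.minCertComplexity : ℝ) < Real.logb 2 (m / Real.logb 2 n) -
          3 * Real.logb 2 (Real.logb 2 (m / Real.logb 2 n))).card : ℝ) ≤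
      2 / n * (2 ^ n).choose m := by
  set b := Real.logb 2 (m / Real.logb 2 n) - 3 * Real.logb 2 (Real.logb 2 (m / Real.logb 2 n))
    with hb
  rcases le_or_gt b 0 with hb0 | hb0
  · rw [Finset.filter_false_of_mem fun f _ hf =>
      absurd (hf.2.trans_le hb0) (not_lt.2 (Nat.cast_nonneg _))]
    simp only [Finset.card_empty, Nat.cast_zero]
    positivity
  have h2 : 2 * m ≤ 2 ^ n := by
    calc 2 * m ≤ 2 * 2 ^ (n - 1) := by omega
      _ = 2 ^ n := by rw [← pow_succ', Nat.sub_add_cancel (by omega)]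
  have hceil : 0 < ⌈b⌉₊ := Nat.ceil_pos.2 hb0
  -- `⌈b⌉₊ - 1` is the largest natural number strictly below `b`, so it serves as `K`.
  have hKb : ((⌈b⌉₊ - 1 : ℕ) : ℝ) < b := Nat.lt_ceil.1 (by omega)
  have hn2 : (2 : ℝ) ≤ n := by exact_mod_cast hn
  have hl1 : 1 ≤ Real.logb 2 (n : ℝ) := by
    rw [Real.le_logb_iff_rpow_le (by norm_num) (by linarith)]; simpa using hn2
  have hr4 : 4 ≤ (m : ℝ) / Real.logb 2 n := by rwa [le_div_iff₀ (by linarith)]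
  have hL2 : 2 ≤ Real.logb 2 ((m : ℝ) / Real.logb 2 n) := by
    rw [Real.le_logb_iff_rpow_le (by norm_num) (by linarith)]; norm_num; exact hr4
  have hLn : Real.logb 2 ((m : ℝ) / Real.logb 2 n) ≤ n := by
    rw [Real.logb_le_iff_le_rpow (by norm_num) (by linarith), Real.rpow_natCast]
    refine (div_le_self (Nat.cast_nonneg _) hl1).trans ?_
    exact_mod_cast (by omega : m ≤ 2 ^ n)
  have hK : ⌈b⌉₊ - 1 ≤ n := by
    have hLL := Real.logb_nonneg (b := 2) (by norm_num) (one_le_two.trans hL2)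
    have : ((⌈b⌉₊ - 1 : ℕ) : ℝ) ≤ n := by linarith
    exact_mod_cast this
  have hmono : (Finset.univ.filter fun f : BoolFun n => f.weight = m ∧
      (f.minCertComplexity : ℝ) < b) ⊆
      Finset.univ.filter fun f : BoolFun n => f.weight = m ∧ f.minCertComplexity ≤ ⌈b⌉₊ - 1 := by
    refine Finset.monotone_filter_right _ fun f _ hf => ⟨hf.1, ?_⟩
    have := Nat.lt_ceil.2 hf.2
    omega
  have h₁ := card_weight_and_minCertComplexity_le (n := n) h2 hK
  have h₂ := choose_mul_two_pow_mul_exp_le hn hm hKb.le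
  have h₃ : ((Finset.univ.filter fun f : BoolFun n => f.weight = m ∧
      (f.minCertComplexity : ℝ) < b).card : ℝ) ≤
      (Finset.univ.filter fun f : BoolFun n =>
        f.weight = m ∧ f.minCertComplexity ≤ ⌈b⌉₊ - 1).card := by
    exact_mod_cast Finset.card_le_card hmono
  calc _ ≤ _ := h₃.trans h₁
    _ = 2 * (2 ^ n).choose m * ((n.choose (⌈b⌉₊ - 1) : ℝ) * 2 ^ (⌈b⌉₊ - 1) *
          Real.exp (-(m / 2 ^ (⌈b⌉₊ - 1)))) := by ring
    _ ≤ 2 * (2 ^ n).choose m * (1 / n) := by gcongr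
    _ = _ := by ring

end BoolFun

theorem theorem2 :
    ∃ C : ℝ, 0 < C ∧ ∀ m : ℕ → ℕ,
      (∀ᶠ n : ℕ in atTop, 4 * Real.logb 2 (n : ℝ) ≤ (m n : ℝ) ∧ m n ≤ 2 ^ (n - 1)) →
      AlmostAllOfWeight m (fun n f =>
        (f.minCertComplexity : ℝ) ≤ f.dAve ∧
        Real.logb 2 ((m n : ℝ) / Real.logb 2 (n : ℝ)) -
            C * Real.logb 2 (Real.logb 2 ((m n : ℝ) / Real.logb 2 (n : ℝ))) ≤
          (f.minCertComplexity : ℝ)) := by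
  -- With `3`, `L^3 - 2L ≥ 1` holds for all `L ≥ 2`; with `2`, the corresponding `L^2 - 2L` would
  -- vanish at `L = 2`.
  refine ⟨3, by norm_num, fun m hm => ?_⟩
  have hlim : Tendsto (fun n : ℕ => 1 - 2 / (n : ℝ)) atTop (𝓝 1) := by
    simpa using (tendsto_const_div_atTop_nhds_zero_nat (2 : ℝ)).const_sub 1
  refine tendsto_of_tendsto_of_tendsto_of_le_of_le' hlim tendsto_const_nhds ?_ ?_
  · filter_upwards [hm, eventually_ge_atTop 2] with n ⟨h₁, h₂⟩ hn
    have hbad := BoolFun.card_weight_and_minCertComplexity_lt hn h₁ h₂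
    set b := Real.logb 2 (m n / Real.logb 2 n) -
      3 * Real.logb 2 (Real.logb 2 (m n / Real.logb 2 n))
    have hmN : m n ≤ 2 ^ n := h₂.trans (Nat.pow_le_pow_right two_pos (Nat.sub_le _ _))
    have hpos : (0 : ℝ) < (2 ^ n).choose (m n) := by exact_mod_cast Nat.choose_pos hmN
    have hcover : BoolFun.ofWeight n (m n) ⊆
        {f ∈ BoolFun.ofWeight n (m n) | (f.minCertComplexity : ℝ) ≤ f.dAve ∧
          b ≤ (f.minCertComplexity : ℝ)} ∪
        ↑(Finset.univ.filter fun f : BoolFun n => f.weight = m n ∧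
          (f.minCertComplexity : ℝ) < b) := by
      intro f hf
      rcases le_or_gt b f.minCertComplexity with h | h
      · exact Or.inl ⟨hf, f.minCertComplexity_le_dAve, h⟩
      · exact Or.inr (by simpa using ⟨hf, h⟩)
    have hcard := (Set.ncard_le_ncard hcover (Set.toFinite _)).trans (Set.ncard_union_le _ _)
    rw [Set.ncard_coe_finset, BoolFun.ncard_ofWeight] at hcard
    rw [BoolFun.ncard_ofWeight, le_div_iff₀ hpos]
    have hcard' := (Nat.cast_le (α := ℝ)).2 hcard
    rw [Nat.cast_add] at hcard'
    linarith
  · refine Eventually.of_forall fun n => div_le_one_of_le₀ ?_ (Nat.cast_nonneg _)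
    exact_mod_cast Set.ncard_le_ncard (Set.sep_subset _ _) (Set.toFinite _)
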